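/- Let $H$ be a semisimple Hopf algebra over a field $k$, with comultiplication $\Delta(h)=\sum h_1\otimes h_2$, counit $\varepsilon$ and antipode $S$. A Hopf subalgebra $A\subseteq H$ is normal if $\sum h_1 a S(h_2)\in A$ and $\sum S(h_1) a h_2\in A$ for all $h\in H$, $a\in A$. An exact normal factorization of $H$ is a pair $(A,L)$ of normal Hopf subalgebras of $H$, both semisimple, such that multiplication $a\otimes l\mapsto al$ is an isomorphism of Hopf algebras $A\otimes L\to H$. Consider also the pairs $(\pi_1,\pi_2)$ of Hopf algebra endomorphisms of $H$ such that, for $i=1,2$: 1. $\pi_i$ is normal: $\pi_i\big(\sum h_1 a S(h_2)\big)=\sum h_1\pi_i(a)S(h_2)$ for all $h,a\in H$; 2. $\pi_i\circ\pi_i=\pi_i$; 3. $\pi_2\star\pi_1=\pi_1\star\pi_2=\mathrm{id}_H$, where $(f\star g)(h)=\sum f(h_1)g(h_2)$; 4. $\pi_2\circ\pi_1=\pi_1\circ\pi_2=\varepsilon(\cdot)1$. Theorem. There is a bijection from the set of exact normal factorizations $(A,L)$ of $H$ to the set of such pairs $(\pi_1,\pi_2)$. It sends $(A,L)$ to the pair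 with $\pi_1(al)=\varepsilon(l)a$ and $\pi_2(al)=\varepsilon(a)l$ for $a\in A$, $l\in L$, and its inverse sends $(\pi_1,\pi_2)$ to $(\pi_1(H),\pi_2(H))$. If $(A,L)$ corresponds to $(\pi_1,\pi_2)$, then $(L,A)$ is also an exact normal factorization and corresponds to $(\pi_2,\pi_1)$; so the bijection also holds for unordered pairs. -/

import Mathlib

open scoped TensorProduct
open Coalgebra HopfAlgebra

/-- A Hopf subalgebra of `H`: a subalgebra `A` with `Δ(A) ⊆ A ⊗ A` (the image of `A ⊗ A` in
`H ⊗ H`) and `S(A) ⊆ A`. -/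
@[ext]
structure HopfSubalgebra (k H : Type*) [Field k] [Ring H] [HopfAlgebra k H]
    extends Subalgebra k H where
  comul_mem' : ∀ x ∈ toSubalgebra, comul (R := k) x ∈
    (Algebra.TensorProduct.map toSubalgebra.val toSubalgebra.val).range
  antipode_mem' : ∀ x ∈ toSubalgebra, antipode k x ∈ toSubalgebra

namespace HopfSubalgebra

variable {k H : Type*} [Field k] [Ring H] [HopfAlgebra k H] (A : HopfSubalgebra k H)

/-- The inclusion `A ⊗ A → H ⊗ H`. -/
noncomputable def incl₂ : A.toSubalgebra ⊗[k] A.toSubalgebra →ₐ[k] H ⊗[k] H :=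
  Algebra.TensorProduct.map A.val A.val

theorem incl₂_injective : Function.Injective A.incl₂ :=
  TensorProduct.map_injective_of_flat_flat A.val.toLinearMap A.val.toLinearMap
    Subtype.val_injective Subtype.val_injective

/-- The comultiplication of `H` restricted to a map `A → A ⊗ A`. -/
noncomputable def comulRestrict : A.toSubalgebra →ₐ[k] A.toSubalgebra ⊗[k] A.toSubalgebra :=
  (AlgEquiv.ofInjective A.incl₂ A.incl₂_injective).symm.toAlgHom.comp
    (((Bialgebra.comulAlgHom k H).comp A.val).codRestrict A.incl₂.range
      (fun a => A.comul_mem' a a.2))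

theorem incl₂_comulRestrict (a : A.toSubalgebra) :
    A.incl₂ (A.comulRestrict a) = comul (R := k) (a : H) :=
  congrArg Subtype.val ((AlgEquiv.ofInjective A.incl₂ A.incl₂_injective).apply_symm_apply
    (((Bialgebra.comulAlgHom k H).comp A.val).codRestrict A.incl₂.range
      (fun a => A.comul_mem' a a.2) a))

/-- The counit of `H` restricted to `A`. -/
noncomputable def counitRestrict : A.toSubalgebra →ₐ[k] k :=
  (Bialgebra.counitAlgHom k H).comp A.val

/-- The antipode of `H` restricted to a map `A → A`. -/
noncomputable def antipodeRestrict : A.toSubalgebra →ₗ[k] A.toSubalgebra :=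
  LinearMap.codRestrict (Subalgebra.toSubmodule A.toSubalgebra)
    (antipode k (A := H) ∘ₗ A.val.toLinearMap) (fun a => A.antipode_mem' a a.2)



theorem map_comp_comulRestrict :
    TensorProduct.map A.val.toLinearMap A.val.toLinearMap ∘ₗ A.comulRestrict.toLinearMap =
      comul ∘ₗ A.val.toLinearMap :=
  LinearMap.ext A.incl₂_comulRestrict

noncomputable instance : Bialgebra k A.toSubalgebra := by
  refine .ofAlgHom A.comulRestrict A.counitRestrict ?_ ?_ ?_
  · refine AlgHom.ext fun a => ?_
    have hinj : Function.Injective (TensorProduct.map A.val.toLinearMap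
        (TensorProduct.map A.val.toLinearMap A.val.toLinearMap)) :=
      TensorProduct.map_injective_of_flat_flat _ _ Subtype.val_injective A.incl₂_injective
    apply hinj
    have e := A.map_comp_comulRestrict
    have h1 : TensorProduct.map A.val.toLinearMap
        (TensorProduct.map A.val.toLinearMap A.val.toLinearMap) ∘ₗ
        (TensorProduct.assoc k _ _ _).toLinearMap ∘ₗ
        A.comulRestrict.toLinearMap.rTensor _ ∘ₗ A.comulRestrict.toLinearMap =
        (TensorProduct.assoc k _ _ _).toLinearMap ∘ₗ (comul (R := k) (A := H)).rTensor _ ∘ₗ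
          comul ∘ₗ A.val.toLinearMap := by
      have h3 : TensorProduct.map (TensorProduct.map A.val.toLinearMap A.val.toLinearMap)
          A.val.toLinearMap ∘ₗ A.comulRestrict.toLinearMap.rTensor _ =
          (comul (R := k) (A := H)).rTensor _ ∘ₗ
            TensorProduct.map A.val.toLinearMap A.val.toLinearMap := by
        rw [LinearMap.map_comp_rTensor, LinearMap.rTensor_comp_map, e]
      rw [← e, ← LinearMap.comp_assoc, TensorProduct.map_map_comp_assoc_eq, LinearMap.comp_assoc,
        ← LinearMap.comp_assoc _ (LinearMap.rTensor _ _), h3, LinearMap.comp_assoc]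
    have h2 : TensorProduct.map A.val.toLinearMap
        (TensorProduct.map A.val.toLinearMap A.val.toLinearMap) ∘ₗ
        A.comulRestrict.toLinearMap.lTensor _ ∘ₗ A.comulRestrict.toLinearMap =
        (comul (R := k) (A := H)).lTensor _ ∘ₗ comul ∘ₗ A.val.toLinearMap := by
      rw [← e, ← LinearMap.comp_assoc, ← LinearMap.comp_assoc, LinearMap.map_comp_lTensor,
        LinearMap.lTensor_comp_map, e]
    refine (LinearMap.congr_fun h1 a).trans (Eq.trans ?_ (LinearMap.congr_fun h2 a).symm)
    exact Coalgebra.coassoc_apply (a : H)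
  · refine AlgHom.ext fun a => ?_
    have hinj : Function.Injective (A.val.toLinearMap.lTensor k) :=
      Module.Flat.lTensor_preserves_injective_linearMap _ Subtype.val_injective
    apply hinj
    have h1 : A.val.toLinearMap.lTensor k ∘ₗ A.counitRestrict.toLinearMap.rTensor _ ∘ₗ
        A.comulRestrict.toLinearMap = (counit (R := k) (A := H)).rTensor _ ∘ₗ
          comul ∘ₗ A.val.toLinearMap := by
      rw [← A.map_comp_comulRestrict, ← LinearMap.comp_assoc, ← LinearMap.comp_assoc,
        LinearMap.lTensor_comp_rTensor, LinearMap.rTensor_comp_map]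
      rfl
    exact (LinearMap.congr_fun h1 a).trans (Coalgebra.rTensor_counit_comul (a : H))
  · refine AlgHom.ext fun a => ?_
    have hinj : Function.Injective (A.val.toLinearMap.rTensor k) :=
      Module.Flat.rTensor_preserves_injective_linearMap _ Subtype.val_injective
    apply hinj
    have h1 : A.val.toLinearMap.rTensor k ∘ₗ A.counitRestrict.toLinearMap.lTensor _ ∘ₗ
        A.comulRestrict.toLinearMap = (counit (R := k) (A := H)).lTensor _ ∘ₗ
          comul ∘ₗ A.val.toLinearMap := by
      rw [← A.map_comp_comulRestrict, ← LinearMap.comp_assoc, ← LinearMap.comp_assoc,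
        LinearMap.rTensor_comp_lTensor, LinearMap.lTensor_comp_map]
      rfl
    exact (LinearMap.congr_fun h1 a).trans (Coalgebra.lTensor_counit_comul (a : H))

/-- The Hopf algebra structure on `A` inherited from `H`. -/
noncomputable instance : HopfAlgebra k A.toSubalgebra where
  antipode := A.antipodeRestrict
  mul_antipode_rTensor_comul := by
    refine LinearMap.ext fun a => Subtype.val_injective ?_
    have h1 : A.val.toLinearMap ∘ₗ LinearMap.mul' k A.toSubalgebra ∘ₗ
        A.antipodeRestrict.rTensor _ ∘ₗ A.comulRestrict.toLinearMap =
        LinearMap.mul' k H ∘ₗ (antipode k).rTensor H ∘ₗ comul ∘ₗ A.val.toLinearMap := by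
      rw [← A.map_comp_comulRestrict]
      simp only [← LinearMap.comp_assoc]
      congr 1
      exact TensorProduct.ext' fun x y => rfl
    exact (LinearMap.congr_fun h1 a).trans (HopfAlgebra.mul_antipode_rTensor_comul_apply (a : H))
  mul_antipode_lTensor_comul := by
    refine LinearMap.ext fun a => Subtype.val_injective ?_
    have h1 : A.val.toLinearMap ∘ₗ LinearMap.mul' k A.toSubalgebra ∘ₗ
        A.antipodeRestrict.lTensor _ ∘ₗ A.comulRestrict.toLinearMap =
        LinearMap.mul' k H ∘ₗ (antipode k).lTensor H ∘ₗ comul ∘ₗ A.val.toLinearMap := by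
      rw [← A.map_comp_comulRestrict]
      simp only [← LinearMap.comp_assoc]
      congr 1
      exact TensorProduct.ext' fun x y => rfl
    exact (LinearMap.congr_fun h1 a).trans (HopfAlgebra.mul_antipode_lTensor_comul_apply (a : H))

end HopfSubalgebra

section Normality

variable {k H : Type*} [Field k] [Ring H] [HopfAlgebra k H]

/-- The left adjoint action `h • x = ∑ h₁ x S(h₂)` of `H` on itself. -/
noncomputable def adLeft (k : Type*) {H : Type*} [Field k] [Ring H] [HopfAlgebra k H]
    (h x : H) : H :=
  LinearMap.mul' k H (TensorProduct.map (LinearMap.mulRight k x) (antipode k) (comul h))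

/-- The right adjoint action `x • h = ∑ S(h₁) x h₂` of `H` on itself. -/
noncomputable def adRight (k : Type*) {H : Type*} [Field k] [Ring H] [HopfAlgebra k H]
    (h x : H) : H :=
  LinearMap.mul' k H (TensorProduct.map (antipode k) (LinearMap.mulLeft k x) (comul h))

/-- A Hopf subalgebra is normal if it is stable under both adjoint actions. -/
def HopfSubalgebra.IsNormal (A : HopfSubalgebra k H) : Prop :=
  ∀ h : H, ∀ a ∈ A.toSubalgebra, adLeft k h a ∈ A.toSubalgebra ∧ adRight k h a ∈ A.toSubalgebra

/-- A Hopf algebra endomorphism is normal if it commutes with the (left) adjoint action: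
`φ(h₁ a S(h₂)) = h₁ φ(a) S(h₂)`. -/
def IsNormalEndomorphism (φ : H →ₐc[k] H) : Prop :=
  ∀ h a : H, φ (adLeft k h a) = adLeft k h (φ a)

end Normality

/-- An exact normal factorization of `H`: a pair `(A, L)` of normal Hopf subalgebras, semisimple
as algebras, such that multiplication `a ⊗ l ↦ a l` is an isomorphism of Hopf algebras
`A ⊗ L ≅ H`. -/
@[ext]
structure ExactNormalFactorization (k H : Type*) [Field k] [Ring H] [HopfAlgebra k H] where
  A : HopfSubalgebra k H
  L : HopfSubalgebra k H
  normal_A : A.IsNormal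
  normal_L : L.IsNormal
  semisimple_A : IsSemisimpleRing A.toSubalgebra
  semisimple_L : IsSemisimpleRing L.toSubalgebra
  exists_mul_equiv : ∃ e : (A.toSubalgebra ⊗[k] L.toSubalgebra) ≃ₐc[k] H,
    ∀ (a : A.toSubalgebra) (l : L.toSubalgebra), e (a ⊗ₜ[k] l) = (a : H) * (l : H)

/-- A pair `(π₁, π₂)` of orthogonal normal idempotent Hopf algebra endomorphisms of `H` whose
convolution product, in either order, is the identity map. (Bialgebra maps between Hopf algebras
commute with the antipodes.) -/
@[ext]
structure NormalIdempotentPair (k H : Type*) [Field k] [Ring H] [HopfAlgebra k H] where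
  π₁ : H →ₐc[k] H
  π₂ : H →ₐc[k] H
  normal₁ : IsNormalEndomorphism π₁
  normal₂ : IsNormalEndomorphism π₂
  idem₁ : ∀ h, π₁ (π₁ h) = π₁ h
  idem₂ : ∀ h, π₂ (π₂ h) = π₂ h
  conv₂₁ : WithConv.toConv (π₂ : H →ₗ[k] H) * WithConv.toConv (π₁ : H →ₗ[k] H) =
    WithConv.toConv LinearMap.id
  conv₁₂ : WithConv.toConv (π₁ : H →ₗ[k] H) * WithConv.toConv (π₂ : H →ₗ[k] H) =
    WithConv.toConv LinearMap.id
  orth₂₁ : ∀ h, π₂ (π₁ h) = algebraMap k H (counit h)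
  orth₁₂ : ∀ h, π₁ (π₂ h) = algebraMap k H (counit h)

/-! Write h ▷ x = ∑ h₁ x S(h₂). Both directions rest on one fact: a Hopf image φ(H) commutes with x
exactly when it acts on x through the counit under ▷. Given a factorization, A and L commute
elementwise because multiplication is an algebra map, and id ⊗ ε, ε ⊗ id become the projections.
Each Hopf endomorphism satisfies φ(h ▷ a) = φ(h) ▷ φ(a). Since the complementary image acts
trivially on φ(H), the right side equals h ▷ φ(a), so φ is normal
(`isNormalEndomorphism_of_convMul`). Given a pair, normality and orthogonality make π₂(H) act
trivially on π₁(H), so the images commute (`NormalIdempotentPair.commute`). Multiplication on their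
tensor product is then a Hopf map, surjective since π₁ ⋆ π₂ = id and injective since (π₁ ⊗ π₂) ∘ Δ
undoes it. The images are semisimple as quotients of H. -/

/-! ### Homomorphisms and antipodes -/

open WithConv in
/-- For a bialgebra homomorphism `φ`, the map `S ∘ φ` is a left convolution inverse of `φ`. -/
theorem BialgHom.antipode_comp_convMul {k C D : Type*} [Field k] [Ring C] [Ring D]
    [Bialgebra k C] [HopfAlgebra k D] (φ : C →ₐc[k] D) :
    toConv (antipode k (A := D) ∘ₗ (φ : C →ₗ[k] D)) * toConv (φ : C →ₗ[k] D) = 1 := by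
  refine WithConv.ext (LinearMap.ext fun c => ?_)
  change _ = algebraMap k D (counit c)
  -- Precomposition with a coalgebra map respects convolution, so S ⋆ id = ε can be pulled back
  -- along φ.
  have h := LinearMap.convMul_comp_coalgHom_distrib (toConv (antipode k (A := D)))
    (toConv LinearMap.id) (φ : C →ₗc[k] D)
  rw [LinearMap.antipode_mul_id] at h
  refine (LinearMap.congr_fun h c).symm.trans ?_
  change algebraMap k D (counit (φ c)) = _
  rw [CoalgHomClass.counit_comp_apply]

open WithConv in
/-- A bialgebra homomorphism between Hopf algebras commutes with the antipodes. -/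
theorem BialgHom.map_antipode {k C D : Type*} [Field k] [Ring C] [Ring D]
    [HopfAlgebra k C] [HopfAlgebra k D] (φ : C →ₐc[k] D) (c : C) :
    φ (antipode k c) = antipode k (φ c) := by
  have h : toConv (φ : C →ₗ[k] D) * toConv ((φ : C →ₗ[k] D) ∘ₗ antipode k (A := C)) = 1 := by
    refine WithConv.ext (LinearMap.ext fun c => ?_)
    change _ = algebraMap k D (counit c)
    have h := LinearMap.algHom_comp_convMul_distrib (φ : C →ₐ[k] D) (toConv LinearMap.id)
      (toConv (antipode k (A := C)))
    rw [LinearMap.id_mul_antipode] at h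
    refine (LinearMap.congr_fun h c).symm.trans ?_
    change φ (algebraMap k C (counit c)) = _
    exact AlgHomClass.commutes φ _
  exact (LinearMap.congr_fun (congrArg ofConv
    (left_inv_eq_right_inv φ.antipode_comp_convMul h)) c).symm

theorem Coalgebra.Repr.sum_smul_counit {k C ι : Type*} [Field k] [AddCommGroup C] [Module k C]
    [Coalgebra k C] {c : C} (r : Coalgebra.Repr k c ι) :
    ∑ i ∈ r.index, counit (R := k) (r.right i) • r.left i = c := by
  have h := congrArg (_root_.TensorProduct.rid k C) (sum_tmul_counit_eq r)
  simpa only [map_sum, _root_.TensorProduct.rid_tmul, one_smul] using h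

/-! ### Adjoint actions, commutation and normality -/

section Adjoint

variable {k H ι : Type*} [Field k] [Ring H] [HopfAlgebra k H]

theorem adLeft_eq_sum {h : H} (r : Coalgebra.Repr k h ι) (x : H) :
    adLeft k h x = ∑ i ∈ r.index, r.left i * x * antipode k (r.right i) := by
  simp [adLeft, ← r.eq]

theorem adRight_eq_sum {h : H} (r : Coalgebra.Repr k h ι) (x : H) :
    adRight k h x = ∑ i ∈ r.index, antipode k (r.left i) * (x * r.right i) := by
  simp [adRight, ← r.eq]

theorem adLeft_smul (c : k) (h x : H) : adLeft k h (c • x) = c • adLeft k h x := by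
  simp [adLeft_eq_sum (ℛ k h), Finset.smul_sum]

theorem adRight_smul (c : k) (h x : H) : adRight k h (c • x) = c • adRight k h x := by
  simp [adRight_eq_sum (ℛ k h), Finset.smul_sum]

theorem smul_adLeft (c : k) (h x : H) : adLeft k (c • h) x = c • adLeft k h x := by
  simp [adLeft]

theorem smul_adRight (c : k) (h x : H) : adRight k (c • h) x = c • adRight k h x := by
  simp [adRight]

theorem sum_adLeft (s : Finset ι) (h : ι → H) (x : H) :
    adLeft k (∑ i ∈ s, h i) x = ∑ i ∈ s, adLeft k (h i) x := by
  simp [adLeft]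

theorem sum_adRight (s : Finset ι) (h : ι → H) (x : H) :
    adRight k (∑ i ∈ s, h i) x = ∑ i ∈ s, adRight k (h i) x := by
  simp [adRight]

theorem mul_adLeft (g h x : H) : adLeft k (g * h) x = adLeft k g (adLeft k h x) := by
  rw [adLeft_eq_sum ((ℛ k g).mul (ℛ k h)), adLeft_eq_sum (ℛ k g), adLeft_eq_sum (ℛ k h)]
  simp [Finset.sum_product, antipode_mul_antidistrib, Finset.mul_sum, Finset.sum_mul, mul_assoc]

theorem mul_adRight (g h x : H) : adRight k (g * h) x = adRight k h (adRight k g x) := by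
  rw [adRight_eq_sum ((ℛ k g).mul (ℛ k h)), adRight_eq_sum (ℛ k h), adRight_eq_sum (ℛ k g)]
  simp [Finset.sum_product_right, antipode_mul_antidistrib, Finset.mul_sum, Finset.sum_mul,
    mul_assoc]

theorem adLeft_of_commute {h x : H} (r : Coalgebra.Repr k h ι)
    (hx : ∀ i ∈ r.index, Commute (r.left i) x) : adLeft k h x = counit (R := k) h • x := by
  rw [adLeft_eq_sum r, Finset.sum_congr rfl (fun i hi => by rw [(hx i hi).eq, mul_assoc]),
    ← Finset.mul_sum, sum_mul_antipode_eq_smul, mul_smul_comm, mul_one]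

theorem adRight_of_commute {h x : H} (r : Coalgebra.Repr k h ι)
    (hx : ∀ i ∈ r.index, Commute (r.right i) x) : adRight k h x = counit (R := k) h • x := by
  rw [adRight_eq_sum r, Finset.sum_congr rfl (fun i hi => by rw [← (hx i hi).eq, ← mul_assoc]),
    ← Finset.sum_mul, sum_antipode_mul_eq_smul, smul_mul_assoc, one_mul]

variable (φ ψ : H →ₐc[k] H)

theorem BialgHom.map_adLeft (h x : H) : φ (adLeft k h x) = adLeft k (φ h) (φ x) := by
  rw [adLeft_eq_sum (ℛ k h), adLeft_eq_sum ((ℛ k h).induced φ)]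
  simp [BialgHom.map_antipode]

theorem BialgHom.map_adRight (h x : H) : φ (adRight k h x) = adRight k (φ h) (φ x) := by
  rw [adRight_eq_sum (ℛ k h), adRight_eq_sum ((ℛ k h).induced φ)]
  simp [BialgHom.map_antipode]

open WithConv in
/-- If the image of `φ` acts trivially on `x` under the adjoint action, it commutes with `x`. -/
theorem commute_of_adLeft_eq {x : H}
    (hx : ∀ h, adLeft k (φ h) x = counit (R := k) h • x) (h : H) : Commute (φ h) x := by
  -- The hypothesis is the convolution identity (φ(·)x) ⋆ (S ∘ φ) = ε(·)x; convolving on the right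
  -- with φ cancels S ∘ φ and leaves φ(h)x = xφ(h).
  have e : toConv (LinearMap.mulRight k x ∘ₗ (φ : H →ₗ[k] H)) *
      toConv (antipode k (A := H) ∘ₗ (φ : H →ₗ[k] H)) =
      toConv ((counit (R := k) (A := H)).smulRight x) := by
    refine WithConv.ext (LinearMap.ext fun h => ?_)
    refine Eq.trans ?_ (hx h)
    refine ((ℛ k h).convMul_apply _ _).trans ?_
    rw [adLeft_eq_sum ((ℛ k h).induced φ)]
    rfl
  have e' := congrArg (· * toConv (φ : H →ₗ[k] H)) e
  simp only [mul_assoc, BialgHom.antipode_comp_convMul, mul_one] at e'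
  have e'' := LinearMap.congr_fun (congrArg ofConv e') h
  refine e''.trans (((ℛ k h).convMul_apply _ _).trans ?_)
  change ∑ i ∈ (ℛ k h).index, (counit (R := k) ((ℛ k h).left i) • x) * φ ((ℛ k h).right i) = _
  conv_rhs => rw [← sum_counit_smul (ℛ k h)]
  simp [Finset.mul_sum]

open WithConv in
theorem sum_mul_eq_of_convMul
    (hc : toConv (φ : H →ₗ[k] H) * toConv (ψ : H →ₗ[k] H) = toConv LinearMap.id)
    {h : H} (r : Coalgebra.Repr k h ι) : ∑ i ∈ r.index, φ (r.left i) * ψ (r.right i) = h :=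
  (r.convMul_apply _ _).symm.trans (LinearMap.congr_fun (congrArg ofConv hc) h)

-- Expand h = ∑ φ(h₁)ψ(h₂): the factor ψ(h₂) acts first, through the counit, and ∑ ε(h₂)φ(h₁) =
-- φ(h).
open WithConv in
theorem adLeft_eq_of_convMul
    (hc : toConv (φ : H →ₗ[k] H) * toConv (ψ : H →ₗ[k] H) = toConv LinearMap.id)
    {x : H} (hx : ∀ h, Commute (ψ h) x) (h : H) : adLeft k h x = adLeft k (φ h) x := by
  conv_lhs => rw [← sum_mul_eq_of_convMul φ ψ hc (ℛ k h)]
  conv_rhs => rw [← (ℛ k h).sum_smul_counit]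
  rw [sum_adLeft, map_sum, sum_adLeft]
  refine Finset.sum_congr rfl fun i _ => ?_
  rw [mul_adLeft, adLeft_of_commute ((ℛ k _).induced ψ) fun i _ => hx _, adLeft_smul,
    map_smul, smul_adLeft, CoalgHomClass.counit_comp_apply]

-- For a right action the left factor of a product acts first, hence the order ψ ⋆ φ.
open WithConv in
theorem adRight_eq_of_convMul
    (hc : toConv (ψ : H →ₗ[k] H) * toConv (φ : H →ₗ[k] H) = toConv LinearMap.id)
    {x : H} (hx : ∀ h, Commute (ψ h) x) (h : H) : adRight k h x = adRight k (φ h) x := by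
  conv_lhs => rw [← sum_mul_eq_of_convMul ψ φ hc (ℛ k h)]
  conv_rhs => rw [← sum_counit_smul (ℛ k h)]
  rw [sum_adRight, map_sum, sum_adRight]
  refine Finset.sum_congr rfl fun i _ => ?_
  rw [mul_adRight, adRight_of_commute ((ℛ k _).induced ψ) fun i _ => hx _, adRight_smul,
    map_smul, smul_adRight, CoalgHomClass.counit_comp_apply]

open WithConv in
theorem isNormalEndomorphism_of_convMul
    (hc : toConv (φ : H →ₗ[k] H) * toConv (ψ : H →ₗ[k] H) = toConv LinearMap.id)
    (hx : ∀ x y, Commute (ψ x) (φ y)) : IsNormalEndomorphism φ := fun h a => by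
  rw [φ.map_adLeft, adLeft_eq_of_convMul φ ψ hc (fun _ => hx _ a) h]

end Adjoint

/-! ### Products of commuting homomorphisms, and images -/

/-- The product of two bialgebra homomorphisms with commuting images,
`c ⊗ d ↦ f c * g d`. -/
noncomputable def BialgHom.tensorLift {k C D H : Type*} [Field k] [Ring C] [Ring D] [Ring H]
    [Bialgebra k C] [Bialgebra k D] [Bialgebra k H] (f : C →ₐc[k] H) (g : D →ₐc[k] H)
    (hfg : ∀ c d, Commute ((f : C →ₐ[k] H) c) ((g : D →ₐ[k] H) d)) : C ⊗[k] D →ₐc[k] H :=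
  .ofAlgHom (Algebra.TensorProduct.lift (f : C →ₐ[k] H) (g : D →ₐ[k] H) hfg)
    (by ext <;> simp) (by
      -- Both sides are algebra maps, so compatibility with Δ is checked on each tensor factor
      -- separately.
      ext c
      · have h := CoalgHomClass.map_comp_comul_apply f c
        dsimp
        rw [Bialgebra.comulAlgHom_apply, Bialgebra.comulAlgHom_apply, TensorProduct.comul_tmul]
        rw [← (ℛ k c).eq] at h ⊢
        simpa [TensorProduct.tmul_sum, TensorProduct.sum_tmul, Algebra.TensorProduct.one_def]
          using h
      · have h := CoalgHomClass.map_comp_comul_apply g c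
        dsimp
        rw [Bialgebra.comulAlgHom_apply, Bialgebra.comulAlgHom_apply, TensorProduct.comul_tmul]
        rw [← (ℛ k c).eq] at h ⊢
        simpa [TensorProduct.tmul_sum, TensorProduct.sum_tmul, Algebra.TensorProduct.one_def]
          using h)

theorem BialgHom.tensorLift_tmul {k C D H : Type*} [Field k] [Ring C] [Ring D] [Ring H]
    [Bialgebra k C] [Bialgebra k D] [Bialgebra k H] (f : C →ₐc[k] H) (g : D →ₐc[k] H)
    (hfg : ∀ c d, Commute ((f : C →ₐ[k] H) c) ((g : D →ₐ[k] H) d)) (c : C) (d : D) :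
    BialgHom.tensorLift f g hfg (c ⊗ₜ d) = f c * g d :=
  Algebra.TensorProduct.lift_tmul _ _ hfg _ _

section HopfSubalgebra

variable {k H : Type*} [Field k] [Ring H] [HopfAlgebra k H]

/-- The inclusion of a Hopf subalgebra as a bialgebra homomorphism. -/
noncomputable def HopfSubalgebra.subtype (A : HopfSubalgebra k H) : A.toSubalgebra →ₐc[k] H :=
  .ofAlgHom A.val rfl (AlgHom.ext fun a => A.incl₂_comulRestrict a)

@[simp]
theorem HopfSubalgebra.subtype_apply (A : HopfSubalgebra k H) (a : A.toSubalgebra) :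
    A.subtype a = (a : H) := rfl

theorem HopfSubalgebra.counit_coe (A : HopfSubalgebra k H) (a : A.toSubalgebra) :
    counit (R := k) (a : H) = counit (R := k) a := rfl

/-- The image of a Hopf algebra endomorphism, as a Hopf subalgebra. -/
noncomputable def BialgHom.hopfRange (φ : H →ₐc[k] H) : HopfSubalgebra k H where
  toSubalgebra := (φ : H →ₐ[k] H).range
  comul_mem' := by
    rintro _ ⟨h, rfl⟩
    change comul (φ h) ∈ _
    rw [← ((ℛ k h).induced φ).eq]
    exact sum_mem fun i _ => ⟨⟨φ _, _, rfl⟩ ⊗ₜ ⟨φ _, _, rfl⟩, rfl⟩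
  antipode_mem' := by
    rintro _ ⟨h, rfl⟩
    exact ⟨antipode k h, φ.map_antipode h⟩

theorem BialgHom.isSemisimpleRing_hopfRange [IsSemisimpleRing H] (φ : H →ₐc[k] H) :
    IsSemisimpleRing φ.hopfRange.toSubalgebra :=
  ((φ : H →ₐ[k] H).rangeRestrict : H →+* (φ : H →ₐ[k] H).range).isSemisimpleRing_of_surjective
    (φ : H →ₐ[k] H).rangeRestrict_surjective

end HopfSubalgebra

/-! ### From factorizations to projections -/

namespace ExactNormalFactorization

variable {k H : Type*} [Field k] [Ring H] [HopfAlgebra k H] (F : ExactNormalFactorization k H)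

/-- The multiplication isomorphism `A ⊗ L ≃ H`. -/
noncomputable def mulEquiv : (F.A.toSubalgebra ⊗[k] F.L.toSubalgebra) ≃ₐc[k] H :=
  F.exists_mul_equiv.choose

theorem mulEquiv_tmul (a : F.A.toSubalgebra) (l : F.L.toSubalgebra) :
    F.mulEquiv (a ⊗ₜ l) = (a : H) * (l : H) :=
  F.exists_mul_equiv.choose_spec a l

theorem mulEquiv_symm_mul (a : F.A.toSubalgebra) (l : F.L.toSubalgebra) :
    F.mulEquiv.symm ((a : H) * (l : H)) = a ⊗ₜ l := by
  rw [← mulEquiv_tmul, BialgEquiv.symm_apply_apply]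

/-- Multiplicativity applied to (1 ⊗ l)(a ⊗ 1) = a ⊗ l. -/
theorem commute (a : F.A.toSubalgebra) (l : F.L.toSubalgebra) : Commute (a : H) (l : H) := by
  have h := map_mul F.mulEquiv (1 ⊗ₜ l) (a ⊗ₜ 1)
  simpa [mulEquiv_tmul, commute_iff_eq] using h

/-- The projection `a * l ↦ ε(l) a`. -/
noncomputable def projA : H →ₐc[k] H :=
  F.A.subtype.comp <| (Bialgebra.TensorProduct.rid k k F.A.toSubalgebra : _ →ₐc[k] _).comp <|
    (Bialgebra.TensorProduct.map (.id k _) (Bialgebra.counitBialgHom k F.L.toSubalgebra)).comp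
      F.mulEquiv.symm.toBialgHom

/-- The projection `a * l ↦ ε(a) l`. -/
noncomputable def projL : H →ₐc[k] H :=
  F.L.subtype.comp <| (Bialgebra.TensorProduct.lid k F.L.toSubalgebra : _ →ₐc[k] _).comp <|
    (Bialgebra.TensorProduct.map (Bialgebra.counitBialgHom k F.A.toSubalgebra) (.id k _)).comp
      F.mulEquiv.symm.toBialgHom

theorem projA_mul (a : F.A.toSubalgebra) (l : F.L.toSubalgebra) :
    F.projA ((a : H) * (l : H)) = counit (R := k) l • (a : H) := by
  change ((Bialgebra.TensorProduct.rid k k F.A.toSubalgebra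
    (Bialgebra.TensorProduct.map (.id k _) (Bialgebra.counitBialgHom k F.L.toSubalgebra)
      (F.mulEquiv.symm ((a : H) * (l : H)))) : F.A.toSubalgebra) : H) = _
  rw [mulEquiv_symm_mul]
  rfl

theorem projL_mul (a : F.A.toSubalgebra) (l : F.L.toSubalgebra) :
    F.projL ((a : H) * (l : H)) = counit (R := k) a • (l : H) := by
  change ((Bialgebra.TensorProduct.lid k F.L.toSubalgebra
    (Bialgebra.TensorProduct.map (Bialgebra.counitBialgHom k F.A.toSubalgebra) (.id k _)
      (F.mulEquiv.symm ((a : H) * (l : H)))) : F.L.toSubalgebra) : H) = _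
  rw [mulEquiv_symm_mul]
  rfl

/-- Linear maps on `H` that agree on all products `a * l` are equal. -/
theorem linearMap_ext {M : Type*} [AddCommGroup M] [Module k M] {f g : H →ₗ[k] M}
    (h : ∀ (a : F.A.toSubalgebra) (l : F.L.toSubalgebra),
      f ((a : H) * (l : H)) = g ((a : H) * (l : H))) : f = g := by
  refine LinearMap.ext fun x => ?_
  obtain ⟨t, rfl⟩ : ∃ t, F.mulEquiv t = x := ⟨F.mulEquiv.symm x, F.mulEquiv.apply_symm_apply x⟩
  induction t with
  | zero => simp
  | tmul a l => rw [mulEquiv_tmul, h]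
  | add s t hs ht => rw [map_add, map_add, map_add, hs, ht]

theorem projA_mem (h : H) : F.projA h ∈ F.A.toSubalgebra :=
  Subtype.property (Bialgebra.TensorProduct.rid k k F.A.toSubalgebra _)

theorem projL_mem (h : H) : F.projL h ∈ F.L.toSubalgebra :=
  Subtype.property (Bialgebra.TensorProduct.lid k F.L.toSubalgebra _)

theorem projA_coe (a : F.A.toSubalgebra) : F.projA (a : H) = a := by
  simpa using F.projA_mul a 1

theorem projL_coe (l : F.L.toSubalgebra) : F.projL (l : H) = l := by
  simpa using F.projL_mul 1 l

theorem projA_coe_L (l : F.L.toSubalgebra) :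
    F.projA (l : H) = algebraMap k H (counit (l : H)) := by
  rw [HopfSubalgebra.counit_coe]
  simpa [Algebra.algebraMap_eq_smul_one] using F.projA_mul 1 l

theorem projL_coe_A (a : F.A.toSubalgebra) :
    F.projL (a : H) = algebraMap k H (counit (a : H)) := by
  rw [HopfSubalgebra.counit_coe]
  simpa [Algebra.algebraMap_eq_smul_one] using F.projL_mul a 1

theorem commute_proj (x y : H) : Commute (F.projA x) (F.projL y) :=
  F.commute ⟨_, F.projA_mem x⟩ ⟨_, F.projL_mem y⟩

-- On Δ(al) = ∑ a₁l₁ ⊗ a₂l₂ the projections give ε(l₁)a₁ and ε(a₂)l₂, and the counit axioms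
-- reassemble al.
open WithConv in
theorem projA_convMul_projL : toConv (F.projA : H →ₗ[k] H) * toConv (F.projL : H →ₗ[k] H) =
    toConv LinearMap.id := by
  refine WithConv.ext (F.linearMap_ext fun a l => ?_)
  refine ((((ℛ k a).induced F.A.subtype).mul ((ℛ k l).induced F.L.subtype)).convMul_apply
    _ _).trans ?_
  change ∑ i ∈ (ℛ k a).index ×ˢ (ℛ k l).index,
    F.projA (((ℛ k a).left i.1 : H) * ((ℛ k l).left i.2 : H)) *
      F.projL (((ℛ k a).right i.1 : H) * ((ℛ k l).right i.2 : H)) = (a : H) * (l : H)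
  have ha := congrArg F.A.subtype (ℛ k a).sum_smul_counit
  have hl := congrArg F.L.subtype (sum_counit_smul (ℛ k l))
  simp only [map_sum, map_smul, HopfSubalgebra.subtype_apply] at ha hl
  conv_rhs => rw [← ha, ← hl]
  rw [Finset.sum_mul_sum, Finset.sum_product]
  refine Finset.sum_congr rfl fun i _ => Finset.sum_congr rfl fun j _ => ?_
  rw [projA_mul, projL_mul, smul_mul_smul_comm, smul_mul_smul_comm, mul_comm]

open WithConv in
theorem projL_convMul_projA : toConv (F.projL : H →ₗ[k] H) * toConv (F.projA : H →ₗ[k] H) =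
    toConv LinearMap.id := by
  refine WithConv.ext (F.linearMap_ext fun a l => ?_)
  refine ((((ℛ k a).induced F.A.subtype).mul ((ℛ k l).induced F.L.subtype)).convMul_apply
    _ _).trans ?_
  change ∑ i ∈ (ℛ k a).index ×ˢ (ℛ k l).index,
    F.projL (((ℛ k a).left i.1 : H) * ((ℛ k l).left i.2 : H)) *
      F.projA (((ℛ k a).right i.1 : H) * ((ℛ k l).right i.2 : H)) = (a : H) * (l : H)
  have ha := congrArg F.A.subtype (sum_counit_smul (ℛ k a))
  have hl := congrArg F.L.subtype (ℛ k l).sum_smul_counit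
  simp only [map_sum, map_smul, HopfSubalgebra.subtype_apply] at ha hl
  conv_rhs => rw [← ha, ← hl]
  rw [Finset.sum_mul_sum, Finset.sum_product]
  refine Finset.sum_congr rfl fun i _ => Finset.sum_congr rfl fun j _ => ?_
  -- Here the L-factor comes out first, so the two factors must be interchanged.
  rw [(F.commute_proj _ _).symm.eq, projA_mul, projL_mul, smul_mul_smul_comm,
    smul_mul_smul_comm, mul_comm]

/-- The pair of projections of an exact normal factorization. -/
noncomputable def toNormalIdempotentPair : NormalIdempotentPair k H where
  π₁ := F.projA
  π₂ := F.projL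
  normal₁ := isNormalEndomorphism_of_convMul _ _ F.projA_convMul_projL
    fun x y => (F.commute_proj y x).symm
  normal₂ := isNormalEndomorphism_of_convMul _ _ F.projL_convMul_projA F.commute_proj
  idem₁ h := F.projA_coe ⟨_, F.projA_mem h⟩
  idem₂ h := F.projL_coe ⟨_, F.projL_mem h⟩
  conv₂₁ := F.projL_convMul_projA
  conv₁₂ := F.projA_convMul_projL
  orth₂₁ h := (F.projL_coe_A ⟨_, F.projA_mem h⟩).trans
    (congrArg _ (CoalgHomClass.counit_comp_apply F.projA h))
  orth₁₂ h := (F.projA_coe_L ⟨_, F.projL_mem h⟩).trans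
    (congrArg _ (CoalgHomClass.counit_comp_apply F.projL h))

end ExactNormalFactorization

/-! ### From idempotent pairs to factorizations -/

namespace NormalIdempotentPair

variable {k H : Type*} [Field k] [Ring H] [HopfAlgebra k H] (P : NormalIdempotentPair k H)

/-- Exchanging the two endomorphisms. -/
def swap : NormalIdempotentPair k H where
  π₁ := P.π₂
  π₂ := P.π₁
  normal₁ := P.normal₂
  normal₂ := P.normal₁
  idem₁ := P.idem₂
  idem₂ := P.idem₁
  conv₂₁ := P.conv₁₂
  conv₁₂ := P.conv₂₁
  orth₂₁ := P.orth₁₂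
  orth₁₂ := P.orth₂₁

/-- By normality π₂(h) ▷ π₁(x) = π₁(π₂(h) ▷ x) = π₁π₂(h) ▷ π₁(x), and orthogonality turns this into
ε(h)π₁(x). -/
theorem commute (x y : H) : Commute (P.π₁ x) (P.π₂ y) := by
  refine (commute_of_adLeft_eq P.π₂ (fun h => ?_) y).symm
  rw [← P.normal₁, P.π₁.map_adLeft, P.orth₁₂,
    Algebra.algebraMap_eq_smul_one, smul_adLeft]
  simp [adLeft, Algebra.TensorProduct.one_def]

theorem isNormal_hopfRange : P.π₁.hopfRange.IsNormal := by
  rintro h _ ⟨x, rfl⟩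
  refine ⟨⟨_, P.normal₁ h x⟩, ?_⟩
  change adRight k h (P.π₁ x) ∈ _
  -- Normality of π₁ concerns only the left action. On the right, h acts on π₁(x) as π₁(h) does,
  -- because π₂(H) commutes with π₁(x).
  rw [adRight_eq_of_convMul P.π₁ P.π₂ P.conv₂₁ (fun y => (P.commute x y).symm),
    ← BialgHom.map_adRight]
  exact ⟨_, rfl⟩

/-- The multiplication map `π₁(H) ⊗ π₂(H) → H`. -/
noncomputable def mulHom :
    P.π₁.hopfRange.toSubalgebra ⊗[k] P.π₂.hopfRange.toSubalgebra →ₐc[k] H :=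
  .tensorLift P.π₁.hopfRange.subtype P.π₂.hopfRange.subtype (by
    rintro ⟨_, x, rfl⟩ ⟨_, y, rfl⟩
    exact P.commute x y)

theorem mulHom_tmul (a : P.π₁.hopfRange.toSubalgebra) (l : P.π₂.hopfRange.toSubalgebra) :
    P.mulHom (a ⊗ₜ l) = (a : H) * (l : H) := BialgHom.tensorLift_tmul _ _ _ _ _

theorem mulHom_surjective : Function.Surjective P.mulHom := fun h => by
  refine ⟨∑ i ∈ (ℛ k h).index, (⟨P.π₁ ((ℛ k h).left i), _, rfl⟩ : P.π₁.hopfRange.toSubalgebra) ⊗ₜ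
    (⟨P.π₂ ((ℛ k h).right i), _, rfl⟩ : P.π₂.hopfRange.toSubalgebra), ?_⟩
  simp only [map_sum, mulHom_tmul]
  exact sum_mul_eq_of_convMul _ _ P.conv₁₂ (ℛ k h)

theorem map_comul_π₁ (h : H) :
    Algebra.TensorProduct.map (P.π₁ : H →ₐ[k] H) (P.π₂ : H →ₐ[k] H) (comul (P.π₁ h)) =
      P.π₁ h ⊗ₜ 1 := by
  have e := congrArg P.π₁ (ℛ k h).sum_smul_counit
  conv_rhs => rw [← e]
  rw [← ((ℛ k h).induced P.π₁).eq]
  simp [P.idem₁, P.orth₂₁, Algebra.algebraMap_eq_smul_one, TensorProduct.sum_tmul,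
    TensorProduct.smul_tmul]

theorem map_comul_π₂ (h : H) :
    Algebra.TensorProduct.map (P.π₁ : H →ₐ[k] H) (P.π₂ : H →ₐ[k] H) (comul (P.π₂ h)) =
      1 ⊗ₜ P.π₂ h := by
  have e := congrArg P.π₂ (sum_counit_smul (ℛ k h))
  conv_rhs => rw [← e]
  rw [← ((ℛ k h).induced P.π₂).eq]
  simp [P.idem₂, P.orth₁₂, Algebra.algebraMap_eq_smul_one, TensorProduct.tmul_sum,
    TensorProduct.smul_tmul]

/-- Applying (π₁ ⊗ π₂) ∘ Δ after multiplication gives the inclusion of π₁(H) ⊗ π₂(H) in H ⊗ H, which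
is injective by flatness over a field. -/
theorem mulHom_injective : Function.Injective P.mulHom := by
  have e : ∀ t, Algebra.TensorProduct.map (P.π₁ : H →ₐ[k] H) (P.π₂ : H →ₐ[k] H)
      (comul (P.mulHom t)) =
      TensorProduct.map P.π₁.hopfRange.val.toLinearMap P.π₂.hopfRange.val.toLinearMap t := by
    intro t
    induction t with
    | zero => simp
    | tmul a l =>
      obtain ⟨_, x, rfl⟩ := a
      obtain ⟨_, y, rfl⟩ := l
      refine (congrArg _ (congrArg _ (P.mulHom_tmul _ _))).trans ?_
      change Algebra.TensorProduct.map (P.π₁ : H →ₐ[k] H) (P.π₂ : H →ₐ[k] H)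
        (comul (P.π₁ x * P.π₂ y)) = P.π₁ x ⊗ₜ P.π₂ y
      rw [Bialgebra.comul_mul, map_mul, map_comul_π₁, map_comul_π₂]
      simp
    | add s t hs ht => rw [map_add, map_add, map_add, map_add, hs, ht]
  intro s t hst
  refine TensorProduct.map_injective_of_flat_flat P.π₁.hopfRange.val.toLinearMap
    P.π₂.hopfRange.val.toLinearMap Subtype.val_injective Subtype.val_injective ?_
  rw [← e, ← e, hst]

/-- The pair of images, as an exact normal factorization. -/
noncomputable def toExactNormalFactorization [IsSemisimpleRing H] :
    ExactNormalFactorization k H where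
  A := P.π₁.hopfRange
  L := P.π₂.hopfRange
  normal_A := P.isNormal_hopfRange
  normal_L := P.swap.isNormal_hopfRange
  semisimple_A := P.π₁.isSemisimpleRing_hopfRange
  semisimple_L := P.π₂.isSemisimpleRing_hopfRange
  exists_mul_equiv := ⟨.ofBijective P.mulHom ⟨P.mulHom_injective, P.mulHom_surjective⟩,
    P.mulHom_tmul⟩

end NormalIdempotentPair

/-! ### The bijection -/

/-- Exact normal factorizations correspond to pairs of normal idempotent endomorphisms. -/
noncomputable def exactNormalFactorizationEquiv (k H : Type*) [Field k] [Ring H]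
    [HopfAlgebra k H] [IsSemisimpleRing H] :
    ExactNormalFactorization k H ≃ NormalIdempotentPair k H where
  toFun F := F.toNormalIdempotentPair
  invFun P := P.toExactNormalFactorization
  left_inv F := by
    refine ExactNormalFactorization.ext
      (HopfSubalgebra.ext (Set.ext fun x => ⟨?_, fun hx => ?_⟩))
      (HopfSubalgebra.ext (Set.ext fun x => ⟨?_, fun hx => ?_⟩))
    · rintro ⟨h, rfl⟩
      exact F.projA_mem h
    · exact ⟨x, F.projA_coe ⟨x, hx⟩⟩
    · rintro ⟨h, rfl⟩
      exact F.projL_mem h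
    · exact ⟨x, F.projL_coe ⟨x, hx⟩⟩
  right_inv P := by
    refine NormalIdempotentPair.ext (BialgHom.coe_linearMap_injective ?_)
      (BialgHom.coe_linearMap_injective ?_) <;>
    refine P.toExactNormalFactorization.linearMap_ext ?_ <;>
    rintro ⟨_, x, rfl⟩ ⟨_, y, rfl⟩
    · refine (P.toExactNormalFactorization.projA_mul _ _).trans ?_
      change counit (R := k) (P.π₂ y) • P.π₁ x = P.π₁ (P.π₁ x * P.π₂ y)
      rw [map_mul, P.idem₁, P.orth₁₂, CoalgHomClass.counit_comp_apply,
        ← Algebra.commutes, ← Algebra.smul_def]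
    · refine (P.toExactNormalFactorization.projL_mul _ _).trans ?_
      change counit (R := k) (P.π₁ x) • P.π₂ y = P.π₂ (P.π₁ x * P.π₂ y)
      rw [map_mul, P.idem₂, P.orth₂₁, CoalgHomClass.counit_comp_apply, ← Algebra.smul_def]

theorem theorem3p7 {k H : Type*} [Field k] [Ring H] [HopfAlgebra k H] [IsSemisimpleRing H] :
    ∃ Φ : ExactNormalFactorization k H ≃ NormalIdempotentPair k H,
      (∀ F : ExactNormalFactorization k H, ∀ a ∈ F.A.toSubalgebra, ∀ l ∈ F.L.toSubalgebra,
        (Φ F).π₁ (a * l) = counit (R := k) l • a ∧ (Φ F).π₂ (a * l) = counit (R := k) a • l) ∧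
      (∀ P : NormalIdempotentPair k H,
        ((Φ.symm P).A.toSubalgebra : Set H) = Set.range P.π₁ ∧
        ((Φ.symm P).L.toSubalgebra : Set H) = Set.range P.π₂) ∧
      (∀ F : ExactNormalFactorization k H, ∃ F' : ExactNormalFactorization k H,
        F'.A = F.L ∧ F'.L = F.A ∧ (Φ F').π₁ = (Φ F).π₂ ∧ (Φ F').π₂ = (Φ F).π₁) := by
  refine ⟨exactNormalFactorizationEquiv k H, fun F a ha l hl =>
    ⟨F.projA_mul ⟨a, ha⟩ ⟨l, hl⟩, F.projL_mul ⟨a, ha⟩ ⟨l, hl⟩⟩, fun P => ⟨rfl, rfl⟩, fun F => ?_⟩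
  have hF := (exactNormalFactorizationEquiv k H).left_inv F
  -- The reversed factorization is taken to be the images of the swapped pair; the two inverse laws
  -- identify its factors and its projections.
  have hP := (exactNormalFactorizationEquiv k H).right_inv F.toNormalIdempotentPair.swap
  exact ⟨F.toNormalIdempotentPair.swap.toExactNormalFactorization,
    congrArg ExactNormalFactorization.L hF, congrArg ExactNormalFactorization.A hF,
    congrArg NormalIdempotentPair.π₁ hP, congrArg NormalIdempotentPair.π₂ hP⟩
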